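/- Consider ten qubits $1,\dots,10$ with the non-interacting Hamiltonian $H=\sum_{l=1}^{10}\tilde H_l$, where $\tilde H_l=\mathbf I\otimes\cdots\otimes H_l\otimes\cdots\otimes\mathbf I$ acts as $H_l=\sum_{i=0}^{1}(E_l+i\alpha_l)|i\rangle\langle i|$ on the $l$-th qubit and $E_l\in\mathbb R$. One qubit, the central one, has gap $\alpha_c>0$, and each of the other nine has the same gap $\alpha>\alpha_c$. For a state $\rho$ of a system with Hamiltonian $K$ write $E(\rho)=\operatorname{Tr}[\rho K]$ for the mean energy and $W(\rho)=\operatorname{Tr}[\rho K]-\min_U\operatorname{Tr}[U\rho U^\dagger K]$ for the ergotropy, the minimum being over all unitaries $U$. For a ten-qubit state $\rho$ with marginals $\rho_1$ (of qubit $1$, Hamiltonian $H_1$) and $\rho_{1^c}$ (of the qubits $2,\dots,10$, with the sum of their local Hamiltonians as Hamiltonian), put $$\Delta_{1|1^c}=W(\rho)-W(\rho_1)-E(\rho_{1^c})+E_g^{1^c},$$ where $E_g^{1^c}$ is the ground state energy of the Hamiltonian of the qubits $2,\dots,10$. Then every ten-qubit state $\rho$ that is separable across the bipartition of qubit $1$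 versus the rest (that is, a finite probabilistic mixture of products of a state of qubit $1$ and a state of the qubits $2,\dots,10$) satisfies $$\Delta_{1|1^c}\le 0\quad\text{if qubit } 1 \text{ is the central qubit (so } \alpha_1=\alpha_c<\alpha_j=\alpha \text{ for all } j\ne 1),$$ $$\Delta_{1|1^c}\le\frac{\alpha-\alpha_c}{2}\quad\text{if } \alpha_1=\alpha.$$ -/

import Mathlib

open scoped Matrix Kronecker ComplexOrder

/-! Operators on the Hilbert space `(ℂ²)^{⊗ ι}` of a finite family `ι` of qubits are written as
matrices in the computational basis, whose vectors are indexed by bit strings `ι → Fin 2`. -/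

/-- Operators on the register of the qubits in `ι`. -/
abbrev QubitOp (ι : Type) : Type := Matrix (ι → Fin 2) (ι → Fin 2) ℂ

/-- Density operators: positive semidefinite with unit trace. -/
def IsDensity {n : Type} [Fintype n] (ρ : Matrix n n ℂ) : Prop :=
  ρ.PosSemidef ∧ ρ.trace = 1

/-- The tensor product `⨂ j, A j` of one-qubit operators. -/
def tensorOp {ι : Type} [Fintype ι] (A : ι → Matrix (Fin 2) (Fin 2) ℂ) : QubitOp ι :=
  Matrix.of fun s t => ∏ j, A j (s j) (t j)

/-- The one-qubit Hamiltonian `∑ i, (E + i α) |i⟩⟨i|`. -/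
noncomputable def qubitHamiltonian (E α : ℝ) : Matrix (Fin 2) (Fin 2) ℂ :=
  Matrix.diagonal fun i => ((E + ((i : ℕ) : ℝ) * α : ℝ) : ℂ)

/-- The non-interacting Hamiltonian `∑ l, I ⊗ ⋯ ⊗ I ⊗ H_l ⊗ I ⊗ ⋯ ⊗ I`, where `H_l` has ground
energy `E l` and gap `α l`. -/
noncomputable def hamiltonian {ι : Type} [Fintype ι] [DecidableEq ι] (E α : ι → ℝ) : QubitOp ι :=
  ∑ l, tensorOp (Function.update (fun _ => 1) l (qubitHamiltonian (E l) (α l)))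

/-- The mean energy `Tr[ρ H]` (a real number for Hermitian `ρ` and `H`). -/
noncomputable def energy {n : Type} [Fintype n] (H ρ : Matrix n n ℂ) : ℝ :=
  (ρ * H).trace.re

/-- The set of all mean energies `Tr[U ρ U† H]`, with `U` unitary. -/
def unitaryEnergies {n : Type} [Fintype n] [DecidableEq n] (H ρ : Matrix n n ℂ) : Set ℝ :=
  {e | ∃ U ∈ Matrix.unitaryGroup n ℂ, e = energy H (U * ρ * Uᴴ)}

/-- The ergotropy `Tr[ρ H] - min_U Tr[U ρ U† H]`, the minimum being over all unitaries. -/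
noncomputable def ergotropy {n : Type} [Fintype n] [DecidableEq n] (H ρ : Matrix n n ℂ) : ℝ :=
  energy H ρ - sInf (unitaryEnergies H ρ)

/-- The infimum in the definition of the ergotropy is a minimum. -/
theorem isLeast_unitaryEnergies {n : Type} [Fintype n] [DecidableEq n] (H ρ : Matrix n n ℂ) :
    IsLeast (unitaryEnergies H ρ) (sInf (unitaryEnergies H ρ)) := by
  have hcl : IsClosed {U : Matrix n n ℂ | U ∈ Matrix.unitaryGroup n ℂ} := by
    have : {U : Matrix n n ℂ | U ∈ Matrix.unitaryGroup n ℂ} = {U | U * Uᴴ = 1} := by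
      ext U
      exact Matrix.mem_unitaryGroup_iff
    rw [this]
    exact isClosed_eq (continuous_id.matrix_mul continuous_id.matrix_conjTranspose) continuous_const
  have hK : IsCompact {U : Matrix n n ℂ | U ∈ Matrix.unitaryGroup n ℂ} := by
    refine IsCompact.of_isClosed_subset (isCompact_univ_pi fun _ : n =>
      isCompact_univ_pi fun _ : n => isCompact_closedBall (0 : ℂ) 1) hcl ?_
    intro U hU i _ j _
    simpa using entry_norm_bound_of_unitary hU i j
  have him : unitaryEnergies H ρ =
      (fun U : Matrix n n ℂ => energy H (U * ρ * Uᴴ)) ''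
        {U : Matrix n n ℂ | U ∈ Matrix.unitaryGroup n ℂ} := by
    ext e
    constructor
    · rintro ⟨U, hU, rfl⟩
      exact ⟨U, hU, rfl⟩
    · rintro ⟨U, hU, rfl⟩
      exact ⟨U, hU, rfl⟩
  have hc : Continuous fun U : Matrix n n ℂ => energy H (U * ρ * Uᴴ) := by
    have h1 : Continuous fun U : Matrix n n ℂ => U * ρ * Uᴴ * H :=
      ((continuous_id.matrix_mul continuous_const).matrix_mul
        continuous_id.matrix_conjTranspose).matrix_mul continuous_const
    exact Complex.continuous_re.comp h1.matrix_trace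
  rw [him]
  exact (hK.image hc).isLeast_sInf (Set.Nonempty.image _ ⟨1, (Matrix.unitaryGroup n ℂ).one_mem⟩)

/-- The ground state energy of a Hermitian `H`: its smallest eigenvalue. -/
noncomputable def groundEnergy {n : Type} [Fintype n] [DecidableEq n] (H : Matrix n n ℂ) : ℝ :=
  sInf (spectrum ℝ H)

section Bipartition

variable {ι : Type} [DecidableEq ι]

/-- An operator on the whole register, seen as an operator on the tensor product of the
register of the qubits in `X` and the register of the remaining qubits. -/
def bipartite (X : Finset ι) (ρ : QubitOp ι) :
    Matrix (({i // i ∈ X} → Fin 2) × ({i // i ∉ X} → Fin 2))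
      (({i // i ∈ X} → Fin 2) × ({i // i ∉ X} → Fin 2)) ℂ :=
  Matrix.reindex (Equiv.piEquivPiSubtypeProd (fun i => i ∈ X) fun _ => Fin 2)
    (Equiv.piEquivPiSubtypeProd (fun i => i ∈ X) fun _ => Fin 2) ρ

variable [Fintype ι]

/-- The reduced operator on `X`: the partial trace over the qubits outside `X`. -/
def reducedIn (X : Finset ι) (ρ : QubitOp ι) : QubitOp {i // i ∈ X} :=
  Matrix.of fun a a' => ∑ b, bipartite X ρ (a, b) (a', b)

/-- The reduced operator on the complement of `X`: the partial trace over the qubits in `X`. -/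
def reducedOut (X : Finset ι) (ρ : QubitOp ι) : QubitOp {i // i ∉ X} :=
  Matrix.of fun b b' => ∑ a, bipartite X ρ (a, b) (a, b')

/-- `ρ` is separable across the cut `X` versus its complement: it is a probabilistic mixture of
finitely many products of a state on `X` and a state on the complement. -/
def IsSeparableAcross (X : Finset ι) (ρ : QubitOp ι) : Prop :=
  ∃ (k : ℕ) (p : Fin k → ℝ) (σ : Fin k → QubitOp {i // i ∈ X})
    (τ : Fin k → QubitOp {i // i ∉ X}),
    (∀ r, 0 ≤ p r) ∧ ∑ r, p r = 1 ∧ (∀ r, IsDensity (σ r)) ∧ (∀ r, IsDensity (τ r)) ∧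
      bipartite X ρ = ∑ r, (p r : ℂ) • (σ r ⊗ₖ τ r)

/-- `Δ_{X|Xᶜ} = W(ρ) - W(ρ_X) - E(ρ_{Xᶜ}) + E_g^{Xᶜ}` for the non-interacting system with local
ground energies `E` and gaps `α`. -/
noncomputable def ergotropyDelta (E α : ι → ℝ) (X : Finset ι) (ρ : QubitOp ι) : ℝ :=
  ergotropy (hamiltonian E α) ρ
    - ergotropy (hamiltonian (fun i : {i // i ∈ X} => E i) fun i => α i) (reducedIn X ρ)
    - energy (hamiltonian (fun i : {i // i ∉ X} => E i) fun i => α i) (reducedOut X ρ)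
    + groundEnergy (hamiltonian (fun i : {i // i ∉ X} => E i) fun i => α i)

end Bipartition

/-!
Writing `P(H, ρ)` for the minimal energy of `ρ` under unitaries, additivity of the mean energy turns
`Δ_{X|Xᶜ}` into `P(H_X, ρ_X) + E_g^{Xᶜ} - P(H, ρ)`. Let `M` be the largest eigenvalue of `ρ_X`.
Placing the weight `M` on the ground level of `H_X` gives
`P(H_X, ρ_X) ≤ E_g^X + (1 - M) ∑_{i ∈ X} α_i`. Separability gives `ρ ≤ ρ_X ⊗ 1 ≤ M` in the Loewner
order, so no unitary can put more than `M` of the weight of `ρ` on the ground level and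
`P(H, ρ) ≥ E_g + (1 - M) m`, where `m` is the smallest gap. Hence
`Δ_{X|Xᶜ} ≤ (1 - M) (∑_{i ∈ X} α_i - m)`, and `M ≥ 2 ^ (-|X|)` since `ρ_X` has unit trace.
-/

open Matrix
open scoped MatrixOrder Finset

section LoewnerOrder

variable {m n 𝕜 : Type*} [RCLike 𝕜]

theorem kronecker_le_kronecker_left [Finite m] [Finite n] {A : Matrix m m 𝕜} {B C : Matrix n n 𝕜}
    (hA : A.PosSemidef) (h : B ≤ C) : A ⊗ₖ B ≤ A ⊗ₖ C := by
  have hsub : A ⊗ₖ C - A ⊗ₖ B = A ⊗ₖ (C - B) := by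
    ext
    simp [mul_sub]
  rw [Matrix.le_iff, hsub]
  exact hA.kronecker h

theorem kronecker_le_kronecker_right [Finite m] [Finite n] {A B : Matrix m m 𝕜} {C : Matrix n n 𝕜}
    (hC : C.PosSemidef) (h : A ≤ B) : A ⊗ₖ C ≤ B ⊗ₖ C := by
  have hsub : B ⊗ₖ C - A ⊗ₖ C = (B - A) ⊗ₖ C := by
    ext
    simp [sub_mul]
  rw [Matrix.le_iff, hsub]
  exact PosSemidef.kronecker h hC

theorem diag_le_diag {A B : Matrix n n 𝕜} (h : A ≤ B) (i : n) : A i i ≤ B i i :=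
  sub_nonneg.mp (PosSemidef.diag_nonneg h)

theorem re_diag_le_of_le_smul_one [DecidableEq n] {A : Matrix n n ℂ} {M : ℝ} (hM : A ≤ M • 1)
    (i : n) : (A i i).re ≤ M := by
  simpa using (Complex.le_def.mp (diag_le_diag hM i)).1

theorem le_smul_one_of_eigenvalues_le [Fintype n] [DecidableEq n] {A : Matrix n n 𝕜}
    (hA : A.IsHermitian) {M : ℝ} (h : ∀ i, hA.eigenvalues i ≤ M) : A ≤ M • 1 := by
  rw [← Algebra.algebraMap_eq_smul_one]
  refine le_algebraMap_of_spectrum_le (ha := hA) ?_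
  rw [hA.spectrum_real_eq_range_eigenvalues]
  rintro _ ⟨i, rfl⟩
  exact h i

theorem conj_unitary_le_smul_one [Fintype n] [DecidableEq n] {A U : Matrix n n 𝕜}
    (hU : U ∈ unitaryGroup n 𝕜) {M : ℝ} (h : A ≤ M • 1) : U * A * Uᴴ ≤ M • 1 :=
  calc U * A * Uᴴ ≤ U * (M • 1) * Uᴴ := star_right_conjugate_le_conjugate h U
    _ = M • (U * Uᴴ) := by rw [Matrix.mul_smul, Matrix.mul_one, Matrix.smul_mul]
    _ = M • 1 := by rw [← star_eq_conjTranspose, mem_unitaryGroup_iff.mp hU]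

end LoewnerOrder

section Density

variable {m n : Type} [Fintype m] [Fintype n]

theorem convex_setOf_isDensity : Convex ℝ {ρ : Matrix n n ℂ | IsDensity ρ} := by
  rintro ρ ⟨hρ, hρt⟩ τ ⟨hτ, hτt⟩ a b ha hb hab
  refine ⟨(hρ.smul ha).add (hτ.smul hb), ?_⟩
  rw [trace_add, trace_smul, trace_smul, hρt, hτt, ← add_smul, hab, one_smul]

theorem IsDensity.kronecker {σ : Matrix m m ℂ} {τ : Matrix n n ℂ} (hσ : IsDensity σ)
    (hτ : IsDensity τ) : IsDensity (σ ⊗ₖ τ) :=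
  ⟨hσ.1.kronecker hτ.1, by rw [trace_kronecker, hσ.2, hτ.2, one_mul]⟩

variable {ρ : Matrix n n ℂ}

theorem IsDensity.re_diag_nonneg (hρ : IsDensity ρ) (s : n) : 0 ≤ (ρ s s).re :=
  (Complex.nonneg_iff.mp hρ.1.diag_nonneg).1

theorem IsDensity.sum_re_diag (hρ : IsDensity ρ) : ∑ s, (ρ s s).re = 1 := by
  rw [← Complex.re_sum]
  exact congrArg Complex.re hρ.2

theorem IsDensity.nonempty (hρ : IsDensity ρ) : Nonempty n := by
  by_contra h
  rw [not_nonempty_iff] at h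
  simpa using hρ.sum_re_diag

variable [DecidableEq n]

theorem IsDensity.conj_unitary (hρ : IsDensity ρ) {U : Matrix n n ℂ} (hU : U ∈ unitaryGroup n ℂ) :
    IsDensity (U * ρ * Uᴴ) := by
  refine ⟨hρ.1.mul_mul_conjTranspose_same U, ?_⟩
  rw [trace_mul_comm, ← Matrix.mul_assoc, ← star_eq_conjTranspose, mem_unitaryGroup_iff'.mp hU,
    Matrix.one_mul, hρ.2]

theorem IsDensity.sum_eigenvalues (hρ : IsDensity ρ) : ∑ i, hρ.1.isHermitian.eigenvalues i = 1 := by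
  have htrace := hρ.2.symm.trans hρ.1.isHermitian.trace_eq_sum_eigenvalues
  exact Complex.ofReal_injective (by simpa using htrace.symm)

theorem IsDensity.le_one (hρ : IsDensity ρ) : ρ ≤ 1 := by
  rw [← one_smul ℝ (1 : Matrix n n ℂ), ← hρ.sum_eigenvalues]
  exact le_smul_one_of_eigenvalues_le hρ.1.isHermitian fun i =>
    Finset.single_le_sum (fun j _ => hρ.1.eigenvalues_nonneg j) (Finset.mem_univ i)

theorem IsDensity.inv_card_le_of_le_smul_one (hρ : IsDensity ρ) {M : ℝ} (hM : ρ ≤ M • 1) :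
    (Fintype.card n : ℝ)⁻¹ ≤ M := by
  have := hρ.nonempty
  rw [inv_le_iff_one_le_mul₀ (by positivity)]
  calc 1 = ∑ s, (ρ s s).re := hρ.sum_re_diag.symm
    _ ≤ ∑ _s : n, M := Finset.sum_le_sum fun s _ => re_diag_le_of_le_smul_one hM s
    _ = M * Fintype.card n := by
      rw [Finset.sum_const, Finset.card_univ, nsmul_eq_mul, mul_comm]

end Density

section PassiveEnergy

variable {n : Type} [Fintype n] [DecidableEq n]

/-- The passive energy `min_U Tr[U ρ U† H]`: the energy left in `ρ` once its ergotropy has been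
extracted. The infimum is attained, by `isLeast_unitaryEnergies`. -/
noncomputable def passiveEnergy (H ρ : Matrix n n ℂ) : ℝ :=
  sInf (unitaryEnergies H ρ)

theorem passiveEnergy_le {H ρ : Matrix n n ℂ} {e : ℝ} (he : e ∈ unitaryEnergies H ρ) :
    passiveEnergy H ρ ≤ e :=
  (isLeast_unitaryEnergies H ρ).2 he

theorem le_passiveEnergy {H ρ : Matrix n n ℂ} {e : ℝ}
    (he : ∀ U ∈ unitaryGroup n ℂ, e ≤ energy H (U * ρ * Uᴴ)) : e ≤ passiveEnergy H ρ := by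
  obtain ⟨U, hU, hmin⟩ := (isLeast_unitaryEnergies H ρ).1
  exact (he U hU).trans_eq hmin.symm

variable {h : n → ℝ} {ρ : Matrix n n ℂ}

theorem energy_diagonal (h : n → ℝ) (ρ : Matrix n n ℂ) :
    energy (diagonal fun s => (h s : ℂ)) ρ = ∑ s, (ρ s s).re * h s := by
  simp [energy, trace, mul_diagonal]

theorem groundEnergy_diagonal (h : n → ℝ) :
    groundEnergy (diagonal fun s => (h s : ℂ)) = ⨅ s, h s := by
  have hspec : spectrum ℝ (diagonal fun s => (h s : ℂ)) = Set.range h := by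
    ext x
    simp [← spectrum.algebraMap_mem_iff ℂ, spectrum_diagonal]
  rw [groundEnergy, hspec, iInf]

theorem sum_eigenvalues_mul_mem_unitaryEnergies (h : n → ℝ) (hρ : ρ.IsHermitian)
    (π : Equiv.Perm n) :
    ∑ s, hρ.eigenvalues (π s) * h s ∈ unitaryEnergies (diagonal fun s => (h s : ℂ)) ρ := by
  set V : Matrix n n ℂ := (hρ.eigenvectorUnitary : Matrix n n ℂ)
  have hV : Vᴴ * V = 1 := mem_unitaryGroup_iff'.mp hρ.eigenvectorUnitary.2
  have hdiag : Vᴴ * ρ * V = diagonal (RCLike.ofReal ∘ hρ.eigenvalues) := by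
    have hspec := hρ.conjStarAlgAut_star_eigenvectorUnitary
    rwa [Unitary.conjStarAlgAut_star_apply] at hspec
  have hconj (B : Matrix n n ℂ) :
      Vᴴ.submatrix π id * B * (Vᴴ.submatrix π id)ᴴ = (Vᴴ * B * V).submatrix π π := by
    ext
    simp [mul_apply]
  refine ⟨Vᴴ.submatrix π id, ?_, ?_⟩
  · rw [mem_unitaryGroup_iff, star_eq_conjTranspose]
    simpa [hV] using hconj 1
  · rw [hconj, hdiag, energy_diagonal]
    simp

theorem IsDensity.exists_le_smul_one_and_passiveEnergy_diagonal_le (hρ : IsDensity ρ) {b : ℝ}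
    (hb : ∀ s, h s ≤ b) (g : n) :
    ∃ M : ℝ, ρ ≤ M • 1 ∧
      passiveEnergy (diagonal fun s => (h s : ℂ)) ρ ≤ M * h g + (1 - M) * b := by
  have := hρ.nonempty
  set ev := hρ.1.isHermitian.eigenvalues
  obtain ⟨i, hi⟩ := Finite.exists_max ev
  set w : n → ℝ := fun s => ev (Equiv.swap i g s)
  have hwg : w g = ev i := congrArg ev (Equiv.swap_apply_right i g)
  have hw : w g + ∑ s ∈ Finset.univ.erase g, w s = 1 := by
    rw [Finset.add_sum_erase _ _ (Finset.mem_univ g), Equiv.sum_comp _ ev, hρ.sum_eigenvalues]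
  refine ⟨ev i, le_smul_one_of_eigenvalues_le _ hi, ?_⟩
  calc passiveEnergy _ ρ
      ≤ ∑ s, w s * h s := passiveEnergy_le (sum_eigenvalues_mul_mem_unitaryEnergies h _ _)
    _ = w g * h g + ∑ s ∈ Finset.univ.erase g, w s * h s :=
      (Finset.add_sum_erase _ _ (Finset.mem_univ g)).symm
    _ ≤ w g * h g + ∑ s ∈ Finset.univ.erase g, w s * b := by
      gcongr with s
      · exact hρ.1.eigenvalues_nonneg _
      · exact hb s
    _ = ev i * h g + (1 - ev i) * b := by
      rw [← Finset.sum_mul, ← hwg, ← hw, add_sub_cancel_left]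

theorem IsDensity.le_energy_diagonal (hρ : IsDensity ρ) {g : n} {m M : ℝ} (hm : 0 ≤ m)
    (hexc : ∀ s, s ≠ g → h g + m ≤ h s) (hM : ρ ≤ M • 1) :
    h g + (1 - M) * m ≤ energy (diagonal fun s => (h s : ℂ)) ρ := by
  set p : n → ℝ := fun s => (ρ s s).re
  have hp : p g + ∑ s ∈ Finset.univ.erase g, p s = 1 := by
    rw [Finset.add_sum_erase _ _ (Finset.mem_univ g), hρ.sum_re_diag]
  calc h g + (1 - M) * m
      ≤ h g + (1 - p g) * m := by
        gcongr
        exact re_diag_le_of_le_smul_one hM g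
    _ = p g * h g + ∑ s ∈ Finset.univ.erase g, p s * (h g + m) := by
        rw [← Finset.sum_mul]
        linear_combination -(h g + m) * hp
    _ ≤ p g * h g + ∑ s ∈ Finset.univ.erase g, p s * h s := by
        gcongr with s hs
        · exact hρ.re_diag_nonneg s
        · exact hexc s (Finset.ne_of_mem_erase hs)
    _ = energy (diagonal fun s => (h s : ℂ)) ρ := by
        rw [energy_diagonal, Finset.add_sum_erase _ (fun s => p s * h s) (Finset.mem_univ g)]

theorem IsDensity.le_passiveEnergy_diagonal (hρ : IsDensity ρ) {g : n} {m M : ℝ} (hm : 0 ≤ m)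
    (hexc : ∀ s, s ≠ g → h g + m ≤ h s) (hM : ρ ≤ M • 1) :
    h g + (1 - M) * m ≤ passiveEnergy (diagonal fun s => (h s : ℂ)) ρ :=
  le_passiveEnergy fun _ hU =>
    (hρ.conj_unitary hU).le_energy_diagonal hm hexc (conj_unitary_le_smul_one hU hM)

end PassiveEnergy

section Register

variable {ι : Type} [Fintype ι]

/-- The energy of the computational basis vector `s` under `hamiltonian E α`. -/
noncomputable def levelEnergy (E α : ι → ℝ) (s : ι → Fin 2) : ℝ :=
  ∑ l, (E l + ((s l : ℕ) : ℝ) * α l)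

variable {E α : ι → ℝ}

@[simp]
theorem levelEnergy_zero (E α : ι → ℝ) : levelEnergy E α 0 = ∑ l, E l := by
  simp [levelEnergy]

theorem levelEnergy_le (hα : ∀ l, 0 ≤ α l) (s : ι → Fin 2) :
    levelEnergy E α s ≤ ∑ l, E l + ∑ l, α l := by
  rw [levelEnergy, ← Finset.sum_add_distrib]
  gcongr with l
  exact mul_le_of_le_one_left (hα l) (mod_cast Nat.le_of_lt_succ (s l).isLt)

theorem sum_add_le_levelEnergy {m : ℝ} (hm : 0 ≤ m) (hα : ∀ l, m ≤ α l) {s : ι → Fin 2}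
    (hs : s ≠ 0) : ∑ l, E l + m ≤ levelEnergy E α s := by
  obtain ⟨j, hj⟩ := Function.ne_iff.mp hs
  have hsj : s j = 1 := Fin.eq_one_of_ne_zero _ hj
  rw [levelEnergy, Finset.sum_add_distrib]
  gcongr
  calc m ≤ ((s j : ℕ) : ℝ) * α j := by simpa [hsj] using hα j
    _ ≤ ∑ l, ((s l : ℕ) : ℝ) * α l :=
      Finset.single_le_sum (f := fun l => ((s l : ℕ) : ℝ) * α l)
        (fun l _ => mul_nonneg (Nat.cast_nonneg _) (hm.trans (hα l))) (Finset.mem_univ j)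

theorem iInf_levelEnergy (hα : ∀ l, 0 ≤ α l) : ⨅ s, levelEnergy E α s = ∑ l, E l := by
  refine le_antisymm ((ciInf_le (Set.finite_range _).bddBelow 0).trans_eq (levelEnergy_zero E α))
    (le_ciInf fun s => ?_)
  rcases eq_or_ne s 0 with rfl | hs
  · rw [levelEnergy_zero]
  · simpa using sum_add_le_levelEnergy le_rfl hα hs

variable [DecidableEq ι]

theorem tensorOp_update_diagonal (l : ι) (d : Fin 2 → ℂ) :
    tensorOp (Function.update (fun _ => 1) l (diagonal d)) = diagonal fun s => d (s l) := by
  ext s t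
  rw [tensorOp, of_apply]
  rcases eq_or_ne s t with rfl | hst
  · rw [diagonal_apply_eq, Fintype.prod_eq_single l fun j hj => by
      rw [Function.update_of_ne hj, one_apply_eq], Function.update_self, diagonal_apply_eq]
  · obtain ⟨j, hj⟩ := Function.ne_iff.mp hst
    rw [diagonal_apply_ne _ hst]
    refine Finset.prod_eq_zero (Finset.mem_univ j) ?_
    rcases eq_or_ne j l with rfl | hjl
    · rw [Function.update_self, diagonal_apply_ne _ hj]
    · rw [Function.update_of_ne hjl, one_apply_ne hj]

theorem hamiltonian_eq_diagonal (E α : ι → ℝ) :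
    hamiltonian E α = diagonal fun s => (levelEnergy E α s : ℂ) := by
  simp_rw [hamiltonian, qubitHamiltonian, tensorOp_update_diagonal, levelEnergy, Complex.ofReal_sum]
  ext s t
  rcases eq_or_ne s t with rfl | hst
  · simp [Matrix.sum_apply]
  · simp [Matrix.sum_apply, diagonal_apply_ne _ hst]

theorem groundEnergy_hamiltonian (hα : ∀ l, 0 ≤ α l) :
    groundEnergy (hamiltonian E α) = ∑ l, E l := by
  rw [hamiltonian_eq_diagonal, groundEnergy_diagonal, iInf_levelEnergy hα]

theorem IsDensity.exists_le_smul_one_and_passiveEnergy_le (hα : ∀ l, 0 ≤ α l) {ρ : QubitOp ι}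
    (hρ : IsDensity ρ) :
    ∃ M : ℝ, ρ ≤ M • 1 ∧
      passiveEnergy (hamiltonian E α) ρ ≤ ∑ l, E l + (1 - M) * ∑ l, α l := by
  obtain ⟨M, hM, hle⟩ :=
    hρ.exists_le_smul_one_and_passiveEnergy_diagonal_le (levelEnergy_le (E := E) hα) 0
  refine ⟨M, hM, ?_⟩
  rw [hamiltonian_eq_diagonal]
  refine hle.trans_eq ?_
  rw [levelEnergy_zero]
  ring

theorem IsDensity.le_passiveEnergy {m M : ℝ} (hm : 0 ≤ m) (hα : ∀ l, m ≤ α l) {ρ : QubitOp ι}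
    (hρ : IsDensity ρ) (hM : ρ ≤ M • 1) :
    ∑ l, E l + (1 - M) * m ≤ passiveEnergy (hamiltonian E α) ρ := by
  rw [hamiltonian_eq_diagonal, ← levelEnergy_zero E α]
  exact hρ.le_passiveEnergy_diagonal hm
    (fun s hs => by simpa using sum_add_le_levelEnergy hm hα hs) hM

end Register

section Cut

variable {ι : Type} [DecidableEq ι] {X : Finset ι} {ρ : QubitOp ι}

theorem bipartite_le_bipartite_iff {σ : QubitOp ι} :
    bipartite X σ ≤ bipartite X ρ ↔ σ ≤ ρ :=
  posSemidef_submatrix_equiv (M := ρ - σ)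
    (Equiv.piEquivPiSubtypeProd (fun i => i ∈ X) fun _ => Fin 2).symm

variable [Fintype ι]

theorem bipartite_smul_one (X : Finset ι) (M : ℝ) : bipartite X (M • 1) = M • 1 := by
  simp [bipartite, submatrix_smul]

theorem sum_cut (X : Finset ι) (f : ι → ℝ) :
    ∑ l, f l = ∑ i : {i // i ∈ X}, f i + ∑ i : {i // i ∉ X}, f i := by
  convert (Fintype.sum_subtype_add_sum_subtype (fun i => i ∈ X) f).symm

theorem sum_bits_cut {R : Type*} [AddCommMonoid R] (X : Finset ι) (f : (ι → Fin 2) → R) :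
    ∑ s, f s = ∑ a, ∑ b,
      f ((Equiv.piEquivPiSubtypeProd (fun i => i ∈ X) fun _ => Fin 2).symm (a, b)) := by
  rw [← Fintype.sum_prod_type', Equiv.sum_comp _ f]

theorem trace_bipartite (X : Finset ι) (ρ : QubitOp ι) : (bipartite X ρ).trace = ρ.trace := by
  simp_rw [trace, sum_bits_cut X, Fintype.sum_prod_type]
  rfl

theorem isDensity_bipartite_iff : IsDensity (bipartite X ρ) ↔ IsDensity ρ :=
  and_congr (posSemidef_submatrix_equiv _) (by rw [trace_bipartite])

theorem trace_reducedIn (X : Finset ι) (ρ : QubitOp ι) : (reducedIn X ρ).trace = ρ.trace := by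
  rw [← trace_bipartite X, trace, trace, Fintype.sum_prod_type]
  rfl

theorem isDensity_reducedIn (hρ : IsDensity ρ) (X : Finset ι) : IsDensity (reducedIn X ρ) := by
  refine ⟨?_, by rw [trace_reducedIn, hρ.2]⟩
  have hsum : reducedIn X ρ = ∑ b, (bipartite X ρ).submatrix (·, b) (·, b) := by
    ext
    simp [reducedIn, Matrix.sum_apply]
  rw [hsum]
  exact posSemidef_sum _ fun b _ => (isDensity_bipartite_iff.mpr hρ).1.submatrix _

theorem levelEnergy_cut (X : Finset ι) (E α : ι → ℝ) (a : {i // i ∈ X} → Fin 2)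
    (b : {i // i ∉ X} → Fin 2) :
    levelEnergy E α ((Equiv.piEquivPiSubtypeProd (fun i => i ∈ X) fun _ => Fin 2).symm (a, b)) =
      levelEnergy (fun i : {i // i ∈ X} => E i) (fun i => α i) a +
        levelEnergy (fun i : {i // i ∉ X} => E i) (fun i => α i) b := by
  simp_rw [levelEnergy]
  rw [sum_cut X]
  congr 1 <;> exact Finset.sum_congr rfl fun i _ => by simp [Equiv.piEquivPiSubtypeProd, i.2]

theorem energy_hamiltonian_cut (X : Finset ι) (E α : ι → ℝ) (ρ : QubitOp ι) :
    energy (hamiltonian E α) ρ =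
      energy (hamiltonian (fun i : {i // i ∈ X} => E i) fun i => α i) (reducedIn X ρ) +
        energy (hamiltonian (fun i : {i // i ∉ X} => E i) fun i => α i) (reducedOut X ρ) := by
  simp_rw [hamiltonian_eq_diagonal, energy_diagonal, sum_bits_cut X, levelEnergy_cut, mul_add,
    Finset.sum_add_distrib]
  congr 1
  · simp [reducedIn, bipartite, Finset.sum_mul]
  · rw [Finset.sum_comm]
    simp [reducedOut, bipartite, Finset.sum_mul]

theorem ergotropyDelta_eq_passiveEnergy (E α : ι → ℝ) (X : Finset ι) (ρ : QubitOp ι) :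
    ergotropyDelta E α X ρ =
      passiveEnergy (hamiltonian (fun i : {i // i ∈ X} => E i) fun i => α i) (reducedIn X ρ) +
        groundEnergy (hamiltonian (fun i : {i // i ∉ X} => E i) fun i => α i) -
        passiveEnergy (hamiltonian E α) ρ := by
  rw [ergotropyDelta, ergotropy, ergotropy, energy_hamiltonian_cut X, passiveEnergy, passiveEnergy]
  ring

namespace IsSeparableAcross

theorem isDensity (hsep : IsSeparableAcross X ρ) : IsDensity ρ := by
  obtain ⟨k, p, σ, τ, hp, hp1, hσ, hτ, hρ⟩ := hsep
  rw [← isDensity_bipartite_iff (X := X), hρ]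
  exact convex_setOf_isDensity.sum_mem (fun r _ => hp r) hp1 fun r _ => (hσ r).kronecker (hτ r)

theorem bipartite_le_reducedIn_kronecker_one (hsep : IsSeparableAcross X ρ) :
    bipartite X ρ ≤ reducedIn X ρ ⊗ₖ (1 : QubitOp {i // i ∉ X}) := by
  obtain ⟨k, p, σ, τ, hp, -, hσ, hτ, hρ⟩ := hsep
  have hred : reducedIn X ρ = ∑ r, (p r : ℂ) • σ r := by
    ext a a'
    simp only [reducedIn, hρ, of_apply, Matrix.sum_apply, Matrix.smul_apply, kronecker_apply,
      smul_eq_mul]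
    rw [Finset.sum_comm]
    refine Finset.sum_congr rfl fun r _ => ?_
    have hτ1 : ∑ b, τ r b b = 1 := (hτ r).2
    rw [← Finset.mul_sum, ← Finset.mul_sum, hτ1, mul_one]
  calc bipartite X ρ = ∑ r, (p r : ℂ) • (σ r ⊗ₖ τ r) := hρ
    _ ≤ ∑ r, (p r : ℂ) • (σ r ⊗ₖ (1 : QubitOp {i // i ∉ X})) :=
      Finset.sum_le_sum fun r _ => smul_le_smul_of_nonneg_left
        (kronecker_le_kronecker_left (hσ r).1 (hτ r).le_one) (by exact_mod_cast hp r)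
    _ = reducedIn X ρ ⊗ₖ 1 := by
      rw [hred]
      ext
      simp [Matrix.sum_apply, Finset.sum_mul, mul_assoc]

theorem le_smul_one (hsep : IsSeparableAcross X ρ) {M : ℝ} (hM : reducedIn X ρ ≤ M • 1) :
    ρ ≤ M • 1 := by
  rw [← bipartite_le_bipartite_iff (X := X), bipartite_smul_one]
  calc bipartite X ρ ≤ reducedIn X ρ ⊗ₖ 1 := hsep.bipartite_le_reducedIn_kronecker_one
    _ ≤ (M • 1) ⊗ₖ 1 := kronecker_le_kronecker_right PosSemidef.one hM
    _ = M • 1 := by rw [smul_kronecker, one_kronecker_one]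

end IsSeparableAcross

end Cut

theorem proposition4_general {ι : Type} [Fintype ι] [DecidableEq ι] (E α : ι → ℝ) {m : ℝ}
    (hm : 0 ≤ m) (hα : ∀ j, m ≤ α j) {X : Finset ι} (hX : X.Nonempty) {ρ : QubitOp ι}
    (hsep : IsSeparableAcross X ρ) :
    ergotropyDelta E α X ρ ≤ (1 - (2 ^ #X)⁻¹) * (∑ i ∈ X, α i - m) := by
  have hα0 (j : ι) : 0 ≤ α j := hm.trans (hα j)
  have hρX := isDensity_reducedIn hsep.isDensity X
  obtain ⟨M, hM, hupper⟩ := hρX.exists_le_smul_one_and_passiveEnergy_le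
    (E := fun i : {i // i ∈ X} => E i) (α := fun i => α i) fun i => hα0 i
  have hlower := hsep.isDensity.le_passiveEnergy (E := E) hm hα (hsep.le_smul_one hM)
  have hcard : (2 ^ #X : ℝ)⁻¹ ≤ M := by simpa using hρX.inv_card_le_of_le_smul_one hM
  have hmX : m ≤ ∑ i ∈ X, α i := by
    obtain ⟨j, hj⟩ := hX
    exact (hα j).trans (Finset.single_le_sum (fun i _ => hα0 i) hj)
  rw [Finset.sum_coe_sort X α] at hupper
  rw [sum_cut X E] at hlower
  calc ergotropyDelta E α X ρ ≤ (1 - M) * (∑ i ∈ X, α i - m) := by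
        rw [ergotropyDelta_eq_passiveEnergy, groundEnergy_hamiltonian fun i : {i // i ∉ X} => hα0 i]
        linarith
    _ ≤ (1 - (2 ^ #X)⁻¹) * (∑ i ∈ X, α i - m) := by gcongr

theorem proposition4
    -- local ground energies and gaps of the ten qubits; qubit 1 has index `0`
    (E gap : Fin 10 → ℝ)
    -- the position of the central qubit
    (c : Fin 10) (αc α : ℝ) (hαc : 0 < αc) (hα : αc < α)
    (hgapc : gap c = αc) (hgap : ∀ j, j ≠ c → gap j = α)
    (ρ : QubitOp (Fin 10)) (hρ : IsDensity ρ)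
    (hsep : IsSeparableAcross {(0 : Fin 10)} ρ) :
    (c = 0 → ergotropyDelta E gap {(0 : Fin 10)} ρ ≤ 0) ∧
    (gap 0 = α → ergotropyDelta E gap {(0 : Fin 10)} ρ ≤ (α - αc) / 2) := by
  have hmin (j : Fin 10) : αc ≤ gap j := by grind
  have h := proposition4_general E gap hαc.le hmin (Finset.singleton_nonempty 0) hsep
  rw [Finset.sum_singleton, Finset.card_singleton] at h
  exact ⟨by rintro rfl; linarith, fun h0 => by linarith⟩
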